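/- Let $\mathbf t = t_0t_1t_2\cdots = 01101001\cdots$ be the Thue–Morse word, that is, the fixed point starting with $0$ of the morphism $0\mapsto 01$, $1\mapsto 10$. A factor of $\mathbf t$ is a word of the form $t_s t_{s+1}\cdots t_{s+n-1}$. For a nonempty finite word $w$, let $p(w)$ be its smallest period, that is, the least $p$ with $1\le p\le |w|$ such that $w[i]=w[i+p]$ for all $0\le i<|w|-p$, and let $\exp(w)=|w|/p(w)$. The circular critical exponent $\operatorname{ccexp}(w)$ is the supremum of $\exp(x)$ over all nonempty factors (contiguous blocks) $x$ of all conjugates (cyclic shifts) of $w$. Theorem. For every nonempty factor $w$ of $\mathbf t$, $$\operatorname{ccexp}(w)\in U:=\left\{1,\,2,\,\tfrac73,\,\tfrac{17}7,\,\tfrac52,\,\tfrac{13}5,\,\tfrac83,\,3,\,\tfrac{10}3,\,\tfrac72,\,\tfrac{11}3,\,4\right\}.$$ Moreover, for every $u\in U$ there is a nonempty factor $w$ of $\mathbf t$ with $\operatorname{ccexp}(w)=u$. -/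

import Mathlib

namespace CircularWords

/-- The morphism `0 ↦ 01`, `1 ↦ 10`, on letters. -/
def mu : Fin 2 → List (Fin 2)
  | 0 => [0, 1]
  | 1 => [1, 0]

theorem length_mu (a : Fin 2) : (mu a).length = 2 := by
  fin_cases a <;> rfl

/-- The Thue-Morse word: the fixed point of `mu` that starts with `0`. The letter at position `n`
is the letter at position `n % 2` of the image under `mu` of the letter at position `n / 2`. -/
def thueMorse : ℕ → Fin 2
  | 0 => 0
  | n + 1 => (mu (thueMorse ((n + 1) / 2)))[(n + 1) % 2]'(by rw [length_mu]; omega)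
decreasing_by omega

/-- The word `t[s..s+n-1]` of length `n` that occurs at position `s` of an infinite word `t`. -/
def block {α : Type*} (t : ℕ → α) (s n : ℕ) : List α :=
  (List.range n).map fun i => t (s + i)

theorem thueMorse_zero : thueMorse 0 = 0 := by
  rw [thueMorse]

/-- Applying `mu` letter by letter to the Thue-Morse word gives the Thue-Morse word. -/
theorem thueMorse_fixed (n : ℕ) : mu (thueMorse n) = block thueMorse (2 * n) 2 := by
  have h0 : ∀ m, thueMorse m = (mu (thueMorse (m / 2)))[m % 2]'(by rw [length_mu]; omega) := by
    intro m
    cases m with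
    | zero => simp [thueMorse_zero, mu]
    | succ m => rw [thueMorse]
  have e : thueMorse (2 * n) = (mu (thueMorse n))[0]'(by rw [length_mu]; omega) := by
    rw [h0]; simp
  have o : thueMorse (2 * n + 1) = (mu (thueMorse n))[1]'(by rw [length_mu]; omega) := by
    rw [h0]
    have : (2 * n + 1) / 2 = n := by omega
    simp [this, Nat.add_mod]
  apply List.ext_getElem
  · simp [block, length_mu]
  · intro i hi _
    rw [length_mu] at hi
    interval_cases i <;> simp [block, e, o]

/-- The finite word `x` is a factor of the infinite word `t`. -/
def IsFactorOf {α : Type*} (x : List α) (t : ℕ → α) : Prop :=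
  ∃ s n : ℕ, x = block t s n

/-- The smallest period of a nonempty finite word `w`, among the periods `p` with `1 ≤ p ≤ |w|`. -/
noncomputable def period {α : Type*} (w : List α) : ℕ :=
  sInf {p : ℕ | 1 ≤ p ∧ p ≤ w.length ∧ w.HasPeriod p}

/-- The exponent `|w| / p(w)` of a nonempty finite word. -/
noncomputable def exponent {α : Type*} (w : List α) : ℝ :=
  (w.length : ℝ) / (period w : ℝ)

/-- The exponents of the nonempty factors of the conjugates (cyclic shifts) of `w`. -/
def circularExponents {α : Type*} (w : List α) : Set ℝ :=
  {e : ℝ | ∃ v x : List α, w ~r v ∧ x <:+: v ∧ x ≠ [] ∧ e = exponent x}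

/-- The circular critical exponent of the finite word `w`. -/
noncomputable def ccexp {α : Type*} (w : List α) : ℝ :=
  sSup (circularExponents w)

theorem period_spec {α : Type*} {w : List α} (hw : w ≠ []) :
    1 ≤ period w ∧ period w ≤ w.length ∧ w.HasPeriod (period w) := by
  refine Nat.sInf_mem (s := {p : ℕ | 1 ≤ p ∧ p ≤ w.length ∧ w.HasPeriod p})
    ⟨w.length, List.length_pos_iff.mpr hw, le_rfl, ?_⟩
  simp [List.HasPeriod]

/-- For a nonempty word the supremum in `ccexp` is that of a nonempty bounded set. -/
theorem isLUB_ccexp {α : Type*} {w : List α} (hw : w ≠ []) :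
    IsLUB (circularExponents w) (ccexp w) := by
  refine isLUB_csSup ⟨exponent w, w, w, List.IsRotated.refl w, List.infix_rfl, hw, rfl⟩
    ⟨w.length, ?_⟩
  rintro e ⟨v, x, hv, hx, hne, rfl⟩
  have h1 : (1 : ℝ) ≤ period x := by exact_mod_cast (period_spec hne).1
  have h2 : (x.length : ℝ) ≤ w.length := by
    exact_mod_cast hv.perm.length_eq ▸ hx.length_le
  exact (div_le_self (Nat.cast_nonneg _) h1).trans h2

/-- The twelve values. -/
def U : Set ℝ :=
  {1, 2, 7 / 3, 17 / 7, 5 / 2, 13 / 5, 8 / 3, 3, 10 / 3, 7 / 2, 11 / 3, 4}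

end CircularWords

/-!
A factor of length `n` at position `s` of the Thue-Morse word `t` is turned into the periodic
sequence `circular t s n`; its circular critical exponent is the largest quotient `m / p` over the
blocks of length `m ≤ n` and period `p` of that sequence (`IsMaxRep`, `ccexp_block`).

If the circular word splits into blocks `01` and `10` also across the seam between its last and its
first letter (`MatchedSeam`), it is a conjugate of the image of a factor of length `n / 2`
(`MatchedSeam.exists_isDoubling`). Repetitions with `m > 2 * p` in an image have an even period and
come from repetitions of at least the same exponent in the preimage, so the critical exponent is that
of the shorter word (`IsMaxRep.double`), and induction on `n` applies.

If the seam is not matched, repetitions with `m > 2 * p` cross the seam, since `t` has no overlaps.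
As a block of length four of `t` determines the parity of its position, a repetition of period
`p ≥ 6` across the seam has length at most `2 * p + 3` (`rep_length_le_of_not_matchedSeam`). Its
exponent therefore exceeds `7 / 3` only if `p ≤ 8`, and then it reaches at most `2 * p ≤ 16` letters
to either side. A finite computation over the pairs of factors of length `16` that meet in an
unmatched seam (`hasMaxRep_seams`) shows that the exponent `7 / 3` is always reached and that the
largest exponent is one of the listed values. Words of length at most `16` are computed as well
(`hasMaxRep_short_words`); every factor of these lengths occurs at one of 64 positions
(`exists_mem_factorStarts`).
-/

namespace CircularWords

/-! ### Repetitions in sequences and in circular words -/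

/-- The block of length `m` at position `j` of the sequence `c` has period `p`. -/
def Rep {α : Type*} (c : ℕ → α) (j m p : ℕ) : Prop :=
  ∀ i, i + p < m → c (j + i) = c (j + i + p)

/-- The periodic sequence that repeats the word `t[s..s+n-1]`. Its blocks of length at most `n` are
the factors of the conjugates of that word. -/
def circular {α : Type*} (t : ℕ → α) (s n : ℕ) : ℕ → α :=
  fun i => t (s + i % n)

theorem Rep.of_eq {α : Type*} {c d : ℕ → α} {j k m p : ℕ} (h : Rep c j m p)
    (hcd : ∀ i < m, d (k + i) = c (j + i)) : Rep d k m p := by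
  intro i hi
  have := h i hi
  rw [add_assoc, hcd i (by omega), hcd (i + p) hi, ← add_assoc, this]

theorem Rep.sub {α : Type*} {c : ℕ → α} {j m p : ℕ} (h : Rep c j m p) {a b : ℕ}
    (hab : a + b ≤ m) : Rep c (j + a) b p := by
  intro i hi
  have := h (a + i) (by omega)
  rwa [← add_assoc] at this

theorem getElem_block {α : Type*} (t : ℕ → α) (s n i : ℕ) (hi : i < (block t s n).length) :
    (block t s n)[i] = t (s + i) := by
  simp [block]

theorem length_block {α : Type*} (t : ℕ → α) (s n : ℕ) : (block t s n).length = n := by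
  simp [block]

theorem hasPeriod_iff_getElem {α : Type*} {w : List α} {p : ℕ} :
    w.HasPeriod p ↔ ∀ i (h : i + p < w.length), w[i] = w[i + p] := by
  rw [List.hasPeriod_iff_getElem?]
  constructor
  · intro h i hi
    have := h i (by omega)
    rw [List.getElem?_eq_getElem (by omega), List.getElem?_eq_getElem (by omega)] at this
    exact Option.some.inj this
  · intro h i hi
    rw [List.getElem?_eq_getElem (by omega), List.getElem?_eq_getElem (by omega), h i (by omega)]

/-- A circular repetition of length `m` and period `p` that maximizes the quotient determines the
circular critical exponent. Its period need not be assumed minimal: maximality forces that. -/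
theorem ccexp_block {α : Type*} (t : ℕ → α) {s n m p j : ℕ} (hp : 1 ≤ p) (hpm : p ≤ m)
    (hmn : m ≤ n) (hrep : Rep (circular t s n) j m p)
    (hmax : ∀ j' m' p', 1 ≤ p' → p' ≤ m' → m' ≤ n → Rep (circular t s n) j' m' p' →
      m' * p ≤ m * p') :
    ccexp (block t s n) = m / p := by
  have upper : ∀ v x : List α, block t s n ~r v → x <:+: v → x ≠ [] →
      x.length * p ≤ m * period x := by
    rintro v x ⟨k, rfl⟩ ⟨a, b, hab⟩ hx
    obtain ⟨h1, h2, h3⟩ := period_spec hx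
    have hlen := congrArg List.length hab
    simp only [List.length_append, List.length_rotate, length_block] at hlen
    refine hmax (a.length + k) _ _ h1 h2 (by omega) ?_
    have key : ∀ i (hi : i < x.length), x[i] = circular t s n (a.length + k + i) := by
      intro i hi
      have e1 : x[i] = ((block t s n).rotate k)[a.length + i]'(by
          rw [List.length_rotate, length_block]; omega) := by
        simp only [← hab, List.append_assoc]
        rw [List.getElem_append_right (by omega), List.getElem_append_left (by omega)]
        simp
      rw [e1, List.getElem_rotate, getElem_block, length_block, circular]
      congr 3
      omega
    intro i hi
    rw [add_assoc _ i, ← key i (by omega), ← key (i + period x) hi]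
    exact hasPeriod_iff_getElem.1 h3 i hi
  have hp0 : (0 : ℝ) < p := by exact_mod_cast hp
  refine IsGreatest.csSup_eq ⟨?_, ?_⟩
  · have hlen : (((block t s n).rotate j).take m).length = m := by
      simp [length_block, hmn]
    have hne : ((block t s n).rotate j).take m ≠ [] := by
      intro h
      rw [h] at hlen
      simp at hlen
      omega
    have hpre : ((block t s n).rotate j).take m <:+: (block t s n).rotate j :=
      (List.take_prefix _ _).isInfix
    refine ⟨_, _, ⟨j, rfl⟩, hpre, hne, ?_⟩
    have le : period (((block t s n).rotate j).take m) ≤ p := by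
      refine Nat.sInf_le ⟨hp, by omega, ?_⟩
      rw [hasPeriod_iff_getElem]
      intro i hi
      rw [hlen] at hi
      have := hrep i hi
      simp only [List.getElem_take, List.getElem_rotate, getElem_block, length_block]
      simp only [circular] at this
      rw [add_comm i j, this]
      congr 3
      omega
    have ge := upper _ _ ⟨j, rfl⟩ hpre hne
    rw [hlen] at ge
    have : p ≤ period (((block t s n).rotate j).take m) :=
      Nat.le_of_mul_le_mul_left ge (by omega)
    rw [exponent, hlen, le_antisymm le this]
  · rintro e ⟨v, x, hv, hx, hne, rfl⟩
    have h := upper v x hv hx hne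
    have h1 : (0 : ℝ) < period x := by exact_mod_cast (period_spec hne).1
    rw [exponent, div_le_div_iff₀ h1 hp0]
    exact_mod_cast h

/-! ### Doubled sequences and overlaps in the Thue-Morse word -/

/-- `c` is the image of the sequence `d` under the Thue-Morse morphism. -/
def IsDoubling (c d : ℕ → Fin 2) : Prop :=
  ∀ i, c (2 * i) = d i ∧ c (2 * i + 1) ≠ d i

theorem isDoubling_thueMorse : IsDoubling thueMorse thueMorse := by
  intro n
  have h := thueMorse_fixed n
  have e : block thueMorse (2 * n) 2 = [thueMorse (2 * n), thueMorse (2 * n + 1)] := rfl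
  rw [e] at h
  generalize thueMorse n = a at *
  fin_cases a <;> simp [mu] at h ⊢ <;> simp [← h.1, ← h.2]

theorem IsDoubling.eq_iff {c d : ℕ → Fin 2} (h : IsDoubling c d) (i k : ℕ) :
    (c (2 * i) = c (2 * k) ↔ d i = d k) ∧ (c (2 * i + 1) = c (2 * k + 1) ↔ d i = d k) := by
  have h1 := h i
  have h2 := h k
  omega

theorem IsDoubling.rep_double {c d : ℕ → Fin 2} (h : IsDoubling c d) {j m p : ℕ}
    (hd : Rep d j m p) : Rep c (2 * j) (2 * m) (2 * p) := by
  intro i hi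
  have := hd (i / 2) (by omega)
  obtain ⟨k, rfl | rfl⟩ := Nat.even_or_odd' i
  · rw [Nat.mul_div_cancel_left _ two_pos] at this
    rw [← mul_add, ← mul_add]
    exact ((h.eq_iff _ _).1).2 this
  · rw [show (2 * k + 1) / 2 = k by omega] at this
    rw [show 2 * j + (2 * k + 1) + 2 * p = 2 * (j + k + p) + 1 by ring,
      show 2 * j + (2 * k + 1) = 2 * (j + k) + 1 by ring]
    exact ((h.eq_iff _ _).2).2 this

theorem IsDoubling.ne_of_even {c d : ℕ → Fin 2} (h : IsDoubling c d) {i : ℕ} (hi : i % 2 = 0) :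
    c i ≠ c (i + 1) := by
  have := h (i / 2)
  rw [show 2 * (i / 2) = i by omega] at this
  omega

/-- With an odd period, every pair of adjacent letters of an overlap is, itself or after a shift by
the period, a block `01` or `10`. So the overlap alternates, which an odd period excludes. -/
theorem IsDoubling.even_of_rep {c d : ℕ → Fin 2} (h : IsDoubling c d) {j m p : ℕ}
    (hc : Rep c j m p) (hm : 2 * p < m) : p % 2 = 0 := by
  by_contra hodd
  have ne : ∀ i < p, c (j + i) ≠ c (j + i + 1) := by
    intro i hi
    by_cases he : (j + i) % 2 = 0
    · exact h.ne_of_even he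
    · have h1 := hc i (by omega)
      have h2 := hc (i + 1) (by omega)
      have h3 := h.ne_of_even (i := j + i + p) (by omega)
      rw [show j + (i + 1) + p = j + i + p + 1 by omega,
        show j + (i + 1) = j + i + 1 by omega] at h2
      rwa [h1, h2]
  have alt : ∀ i ≤ p, (c (j + i) = c j ↔ i % 2 = 0) := by
    intro i
    induction i with
    | zero => simp
    | succ i ih =>
      intro hi
      have h1 := ih (by omega)
      have h2 := ne i (by omega)
      rw [← add_assoc]
      omega
  have h0 := hc 0 (by omega)
  exact hodd ((alt p le_rfl).1 h0.symm)

/-- The quotient of length and period does not decrease, as `(m + 1) / 2` rounds up; and a repetition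
that fits in a circular word of even length gives one that fits in the halved word. -/
theorem IsDoubling.rep_halve {c d : ℕ → Fin 2} (h : IsDoubling c d) {j m q : ℕ}
    (hc : Rep c j m (2 * q)) : Rep d (j / 2) ((m + 1) / 2) q := by
  intro i hi
  have := hc (2 * i) (by omega)
  obtain ⟨k, rfl | rfl⟩ := Nat.even_or_odd' j
  · rw [← mul_add, ← mul_add] at this
    rw [Nat.mul_div_cancel_left _ two_pos]
    exact ((h.eq_iff _ _).1).1 this
  · rw [show 2 * k + 1 + 2 * i + 2 * q = 2 * (k + i + q) + 1 by ring,
      show 2 * k + 1 + 2 * i = 2 * (k + i) + 1 by ring] at this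
    rw [show (2 * k + 1) / 2 = k by omega]
    exact ((h.eq_iff _ _).2).1 this

theorem thueMorse_overlap_free {j m p : ℕ} (hp : 1 ≤ p) (h : Rep thueMorse j m p) :
    m ≤ 2 * p := by
  induction p using Nat.strong_induction_on generalizing j m with
  | _ p ih =>
    by_contra! hm
    have hev := isDoubling_thueMorse.even_of_rep h hm
    obtain ⟨q, rfl⟩ : ∃ q, p = 2 * q := ⟨p / 2, by omega⟩
    have := ih q (by omega) (by omega) (isDoubling_thueMorse.rep_halve h)
    omega

/-- A block of length four of the Thue-Morse word determines the parity of its positions. -/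
theorem thueMorse_parity {i j : ℕ}
    (h : ∀ k < 4, thueMorse (i + k) = thueMorse (j + k)) : i % 2 = j % 2 := by
  -- otherwise the word alternates, and its second occurrence is the middle of `μ(aaa)`
  have key : ∀ i j : ℕ, (∀ k < 4, thueMorse (i + k) = thueMorse (j + k)) →
      i % 2 = 0 → j % 2 ≠ 1 := by
    intro i j h hi hj
    obtain ⟨k, rfl⟩ : ∃ k, j = 2 * k + 1 := ⟨j / 2, by omega⟩
    have h0 := h 0 (by omega)
    have h1 := h 1 (by omega)
    have h2 := h 2 (by omega)
    have h3 := h 3 (by omega)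
    have a0 := isDoubling_thueMorse.ne_of_even hi
    have a2 := isDoubling_thueMorse.ne_of_even (i := i + 2) (by omega)
    have b0 := isDoubling_thueMorse k
    have b1 := isDoubling_thueMorse (k + 1)
    have b2 := isDoubling_thueMorse (k + 2)
    simp only [mul_add, add_assoc, Nat.reduceMul, Nat.reduceAdd, add_zero]
      at h0 h1 h2 h3 a0 a2 b0 b1 b2
    have r : Rep thueMorse k 3 1 := by
      intro l hl
      obtain rfl | rfl : l = 0 ∨ l = 1 := by omega
      · simp only [add_zero]
        omega
      · simp only [add_assoc, Nat.reduceAdd]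
        omega
    have := thueMorse_overlap_free le_rfl r
    omega
  have h1 := key i j h
  have h2 := key j i fun k hk => (h k hk).symm
  omega

/-! ### Circular words whose seam respects the morphism -/

theorem circular_add {α : Type*} (t : ℕ → α) (s n i : ℕ) :
    circular t s n (i + n) = circular t s n i := by
  simp [circular]

theorem Rep.mod_start {α : Type*} {t : ℕ → α} {s n j m p : ℕ}
    (h : Rep (circular t s n) j m p) : Rep (circular t s n) (j % n) m p :=
  h.of_eq fun i _ => by simp [circular, Nat.add_mod]

/-- `m / p` is the largest quotient of length by period of the repetitions of `c` of length at
most `n`, and it is attained by a repetition of length `m` and period `p`. -/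
structure IsMaxRep {α : Type*} (c : ℕ → α) (n m p : ℕ) : Prop where
  one_le : 1 ≤ p
  le : p ≤ m
  length_le : m ≤ n
  exists_rep : ∃ j, Rep c j m p
  maximal : ∀ j' m' p', 1 ≤ p' → p' ≤ m' → m' ≤ n → Rep c j' m' p' → m' * p ≤ m * p'

/-- Doubling keeps the critical exponent if it is at least `2`. The offset `o` admits words whose
conjugate by one letter is an image under the morphism. -/
theorem IsMaxRep.double {c d : ℕ → Fin 2} {n m p o : ℕ} (ho : o ≤ 1)
    (hper : ∀ i, c (i + 2 * n) = c i) (hcd : IsDoubling (fun i => c (i + o)) d)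
    (h : IsMaxRep d n m p) (hmp : 2 * p ≤ m) : IsMaxRep c (2 * n) (2 * m) (2 * p) := by
  obtain ⟨h1, h2, h3, ⟨j, hj⟩, hmax⟩ := h
  refine ⟨by omega, by omega, by omega, ⟨2 * j + o, ?_⟩, ?_⟩
  · exact (hcd.rep_double hj).of_eq fun i _ => by simp only [add_right_comm]
  · intro j' m' p' h1' h2' h3' hr
    by_cases hlong : 2 * p' < m'
    · have hr' : Rep (fun i => c (i + o)) (j' + 2 * n - o) m' p' := by
        refine hr.of_eq fun i _ => ?_
        rw [← hper (j' + i)]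
        congr 1
        omega
      have hev := hcd.even_of_rep hr' hlong
      obtain ⟨q, rfl⟩ : ∃ q, p' = 2 * q := ⟨p' / 2, by omega⟩
      have := hmax _ _ _ (by omega) (by omega) (by omega) (hcd.rep_halve hr')
      have h4 : m' ≤ 2 * ((m' + 1) / 2) := by omega
      nlinarith [Nat.mul_le_mul_right p h4]
    · nlinarith

/-- The circular word `t[s..s+n-1]`, with `t` the Thue-Morse word, splits into blocks `01` and `10`
across its seam as well: `n` is even and, if `s` is odd, the last letter and the first letter
together form such a block. -/
def MatchedSeam (s n : ℕ) : Prop :=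
  n % 2 = 0 ∧ (s % 2 = 1 → thueMorse s ≠ thueMorse (s + n - 1))

/-- A circular factor with a matched seam is, up to a shift by one, the image of a circular factor of
half the length. For odd `s` the last letter of that factor is read off the last letter of the word,
which begins the block that straddles the seam. -/
theorem MatchedSeam.exists_isDoubling {s n : ℕ} (hn : 0 < n) (h : MatchedSeam s (2 * n)) :
    ∃ o ≤ 1, ∃ s', IsDoubling (fun i => circular thueMorse s (2 * n) (i + o))
      (circular thueMorse s' n) := by
  have hmod : ∀ i, 2 * i % (2 * n) = 2 * (i % n) := fun i => Nat.mul_mod_mul_left 2 i n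
  have hmod' : ∀ i, (2 * i + 1) % (2 * n) = 2 * (i % n) + 1 := by
    intro i
    have h1 := Nat.mod_lt i hn
    rw [Nat.add_mod, hmod, Nat.mod_eq_of_lt (a := 1) (by omega), Nat.mod_eq_of_lt (by omega)]
  obtain ⟨k, rfl | rfl⟩ := Nat.even_or_odd' s
  · refine ⟨0, by omega, k, fun i => ?_⟩
    have := isDoubling_thueMorse (k + i % n)
    simp only [circular, add_zero, hmod, hmod']
    rwa [mul_add, add_assoc] at this
  · refine ⟨1, le_rfl, k + 1, fun i => ?_⟩
    have hi := Nat.mod_lt i hn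
    have h1 := isDoubling_thueMorse (k + 1 + i % n)
    simp only [circular, hmod']
    refine ⟨?_, ?_⟩
    · rw [← h1.1]
      congr 1
      ring
    · rw [show 2 * i + 1 + 1 = 2 * (i + 1) by ring, hmod]
      by_cases hlast : i % n + 1 = n
      · -- at the end of the word the second letter of the block is the first letter of the word
        have h2 := h.2 (by omega)
        have h3 : (i + 1) % n = 0 := by
          refine Nat.mod_eq_zero_of_dvd ⟨i / n + 1, ?_⟩
          have := Nat.div_add_mod i n
          rw [mul_add]
          omega
        have h4 := (isDoubling_thueMorse (k + n)).1
        rw [show 2 * k + 1 + 2 * n - 1 = 2 * (k + n) by omega, h4] at h2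
        rw [h3, show k + 1 + i % n = k + n by omega]
        simpa using h2
      · have h3 : (i + 1) % n = i % n + 1 := by
          conv_lhs => rw [← Nat.div_add_mod i n, add_assoc, Nat.mul_add_mod]
          exact Nat.mod_eq_of_lt (by omega)
        have h4 := (isDoubling_thueMorse (k + 1 + i % n)).2
        rw [h3]
        convert h4 using 2
        ring

/-! ### Repetitions across an unmatched seam -/

theorem circular_left (s : ℕ) {α : Type*} (t : ℕ → α) {n j i : ℕ} (h : j + i < n) :
    circular t s n (j + i) = t (s + j + i) := by
  rw [circular, Nat.mod_eq_of_lt h, add_assoc]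

theorem circular_right (s : ℕ) {α : Type*} (t : ℕ → α) {n j i : ℕ} (h : n ≤ j + i)
    (h2 : j + i < 2 * n) : circular t s n (j + i) = t (s + (j + i - n)) := by
  rw [circular, Nat.mod_eq_sub_mod h, Nat.mod_eq_of_lt (by omega)]

/-- A repetition across the seam has at most two periods on either side, since the Thue-Morse word has
no overlaps. -/
theorem Rep.circular_parts {s n j m p : ℕ} (hp : 1 ≤ p) (hj : j < n) (hm : m ≤ n)
    (hs : n ≤ j + m) (h : Rep (circular thueMorse s n) j m p) :
    n - j ≤ 2 * p ∧ j + m - n ≤ 2 * p := by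
  constructor
  · refine thueMorse_overlap_free (j := s + j) hp ?_
    have h1 := h.sub (a := 0) (b := n - j) (by omega)
    exact h1.of_eq fun i hi => by rw [add_zero, circular_left _ _ (by omega)]
  · refine thueMorse_overlap_free (j := s) hp ?_
    have h1 := h.sub (a := n - j) (b := j + m - n) (by omega)
    refine h1.of_eq fun i hi => ?_
    rw [circular_right _ _ (by omega) (by omega)]
    congr 2
    omega

/-- Long repetitions with period at least `6` cannot cross an unmatched seam. For odd length, the
first four letters recur two periods later on the other side of the seam, at a position of the wrong
parity. For even length the period is even, by the parity of blocks of length four, so that the two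
equal letters at the seam recur as a block `01` or `10`. -/
theorem rep_length_le_of_not_matchedSeam {s n j m p : ℕ} (hb : ¬ MatchedSeam s n) (hp : 6 ≤ p)
    (hj : j < n) (hm : m ≤ n) (h : Rep (circular thueMorse s n) j m p) : m ≤ 2 * p + 3 := by
  by_contra! hlong
  -- the repetition meets the seam, since `thueMorse` has no overlaps
  have hs : n < j + m := by
    by_contra! hs
    have : Rep thueMorse (s + j) m p :=
      h.of_eq fun i hi => by rw [circular_left _ _ (by omega)]
    have := thueMorse_overlap_free (by omega) this
    omega
  obtain ⟨hu, hv⟩ := h.circular_parts (by omega) hj hm hs.le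
  -- equal blocks of length four on either side of the seam come from positions of `thueMorse` of the
  -- same parity, and beyond the seam the position is less by `n`
  have window : ∀ i k, k + 4 ≤ m → i ≤ k → (j + i + 4 ≤ n ∨ n ≤ j + i) →
      (j + k + 4 ≤ n ∨ n ≤ j + k) →
      (∀ l < 4, circular thueMorse s n (j + (i + l)) = circular thueMorse s n (j + (k + l))) →
      (i + if n ≤ j + i then n else 0) % 2 = (k + if n ≤ j + k then n else 0) % 2 := by
    intro i k hk hik hi' hk' heq
    have pos : ∀ a, a ≤ k → (j + a + 4 ≤ n ∨ n ≤ j + a) →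
        ∃ b, (∀ l < 4, circular thueMorse s n (j + (a + l)) = thueMorse (b + l)) ∧
          b % 2 = (s + j + a + if n ≤ j + a then n else 0) % 2 := by
      intro a ha hcase
      by_cases hna : n ≤ j + a
      · refine ⟨s + (j + a - n), fun l hl => ?_, ?_⟩
        · rw [circular_right _ _ (by omega) (by omega)]
          congr 1
          omega
        · rw [if_pos hna]
          omega
      · refine ⟨s + j + a, fun l hl => ?_, by rw [if_neg hna]; omega⟩
        rw [circular_left _ _ (by omega)]
        congr 1
        omega
    obtain ⟨b, hb1, hb2⟩ := pos i hik hi'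
    obtain ⟨d, hd1, hd2⟩ := pos k le_rfl hk'
    have := thueMorse_parity (i := b) (j := d) fun l hl => by
      rw [← hb1 l hl, ← hd1 l hl, heq l hl]
    omega
  have shift : ∀ i, i + p < m →
      circular thueMorse s n (j + i) = circular thueMorse s n (j + (i + p)) :=
    fun i hi => by rw [h i hi, add_assoc]
  by_cases hodd : n % 2 = 1
  · -- the first four letters recur at distance `2 * p`, on the other side of the seam
    have := window 0 (2 * p) (by omega) (by omega) (by omega) (by omega) fun l hl => by
      rw [shift _ (by omega), shift _ (by omega)]
      congr 1
      omega
    rw [if_neg (by omega), if_pos (by omega)] at this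
    omega
  · simp only [MatchedSeam, not_and, Classical.not_imp, not_not] at hb
    obtain ⟨hs1, hs2⟩ := hb (by omega)
    have hev : p % 2 = 0 := by
      -- of the windows of length four at `0` and `3`, one avoids the seam with its shift by `p`
      have hw : ∀ i, i ≤ 3 → (j + i + 4 ≤ n ∨ n ≤ j + i) →
          (j + (i + p) + 4 ≤ n ∨ n ≤ j + (i + p)) → p % 2 = 0 := by
        intro i hi h1 h2
        have := window i (i + p) (by omega) (by omega) h1 h2 fun l hl => by
          rw [shift _ (by omega)]
          congr 1
          omega
        split_ifs at this <;> omega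
      by_cases h0 : (j + 0 + 4 ≤ n ∨ n ≤ j + 0) ∧ (j + (0 + p) + 4 ≤ n ∨ n ≤ j + (0 + p))
      · exact hw 0 (by omega) h0.1 h0.2
      · exact hw 3 le_rfl (by omega) (by omega)
    -- the two equal letters at the seam recur, at distance `p`, as the two letters of a block
    have l1 : circular thueMorse s n (n - 1) = circular thueMorse s n n := by
      have := circular_left s thueMorse (n := n) (j := n - 1) (i := 0) (by omega)
      have h2 := circular_right s thueMorse (n := n) (j := n) (i := 0) (by omega) (by omega)
      simp only [add_zero, Nat.sub_self] at this h2
      rw [this, h2, hs2]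
      congr 1
      omega
    by_cases hleft : j + p + 1 ≤ n
    · have e1 := h (n - 1 - p - j) (by omega)
      have e2 := h (n - p - j) (by omega)
      rw [show j + (n - 1 - p - j) + p = n - 1 by omega,
        circular_left _ _ (by omega)] at e1
      rw [show j + (n - p - j) + p = n by omega, circular_left _ _ (by omega)] at e2
      have := isDoubling_thueMorse.ne_of_even (i := s + j + (n - 1 - p - j)) (by omega)
      rw [show s + j + (n - 1 - p - j) + 1 = s + j + (n - p - j) by omega] at this
      exact this (by rw [e1, e2, l1])
    · have e1 := shift (n - 1 - j) (by omega)
      have e2 := shift (n - j) (by omega)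
      rw [show j + (n - 1 - j) = n - 1 by omega, circular_right _ _ (by omega) (by omega)] at e1
      rw [show j + (n - j) = n by omega, circular_right _ _ (by omega) (by omega)] at e2
      have := isDoubling_thueMorse.ne_of_even (i := s + (j + (n - 1 - j + p) - n)) (by omega)
      rw [show s + (j + (n - 1 - j + p) - n) + 1 = s + (j + (n - j + p) - n) by omega] at this
      exact this (by rw [← e1, ← e2, l1])

/-! ### Finite words as numbers -/

/-- A binary number whose bit `j` says that the word given by the low `N` bits of `D` has at `j` a
block of length `p + k` and period `p`. The recursor is used directly because the kernel evaluates
it faster than a compiled recursion. -/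
noncomputable def repStarts (D N p k : ℕ) : ℕ :=
  Nat.rec (2 ^ (N + 1 - p) - 1) (fun i A => A &&&
    (((2 ^ (N - p) - 1) ^^^ ((D ^^^ (D >>> p)) % 2 ^ (N - p))) >>> i)) k

theorem repStarts_succ (D N p k : ℕ) : repStarts D N p (k + 1) = repStarts D N p k &&&
    (((2 ^ (N - p) - 1) ^^^ ((D ^^^ (D >>> p)) % 2 ^ (N - p))) >>> k) :=
  rfl

theorem testBit_repStarts {D N p k j : ℕ} (hp : p ≤ N) :
    (repStarts D N p k).testBit j = true ↔
      j + p + k ≤ N ∧ ∀ i < k, D.testBit (j + i) = D.testBit (j + i + p) := by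
  induction k with
  | zero =>
    change (2 ^ (N + 1 - p) - 1).testBit j = true ↔ _
    simp only [Nat.testBit_two_pow_sub_one, decide_eq_true_eq]
    simp
    omega
  | succ k ih =>
    simp only [repStarts_succ, Nat.testBit_and, Bool.and_eq_true, ih, Nat.testBit_shiftRight,
      Nat.testBit_xor, Nat.testBit_two_pow_sub_one, Nat.testBit_mod_two_pow]
    rw [Nat.forall_lt_succ_right, show p + (k + j) = j + k + p by ring, add_comm k j]
    cases hD : D.testBit (j + k) <;> cases hE : D.testBit (j + k + p) <;> simp <;> grind

/-- The word given by the low `N` bits of `D` has a block of length `m` and period `p`. -/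
noncomputable def hasRep (D N m p : ℕ) : Bool :=
  repStarts D N p (m - p) != 0

theorem hasRep_iff {D N m p : ℕ} (hpm : p ≤ m) (hm : p ≤ N) :
    hasRep D N m p = true ↔ ∃ j, j + m ≤ N ∧ Rep D.testBit j m p := by
  rw [hasRep, bne_iff_ne]
  constructor
  · intro h
    obtain ⟨j, hj⟩ := Nat.exists_testBit_of_ne_zero h
    rw [testBit_repStarts hm] at hj
    exact ⟨j, by omega, fun i hi => hj.2 i (by omega)⟩
  · rintro ⟨j, hj, hr⟩ h0
    have : (repStarts D N p (m - p)).testBit j = true :=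
      (testBit_repStarts hm).2 ⟨by omega, fun i hi => hr i (by omega)⟩
    simp [h0] at this

/-- Some pair `(m, p)` in `l` with `m ≤ M` is the length and a period of a block of the word given by
the low `N` bits of `D`, and no block of length at most `M` with a period at most `P` has a larger
quotient. For the period `k + 1`, the shortest length with a larger quotient is
`m * (k + 1) / p + 1`. -/
noncomputable def hasMaxRep (D N M P : ℕ) (l : List (ℕ × ℕ)) : Bool :=
  l.any fun e => decide (e.1 ≤ M) && hasRep D N e.1 e.2 &&
    (List.range P).all fun k => !(decide (e.1 * (k + 1) / e.2 + 1 ≤ M) &&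
      hasRep D N (e.1 * (k + 1) / e.2 + 1) (k + 1))

/-- The first 112 letters of the Thue-Morse word, the letter at `0` being the lowest bit. -/
def thueMorseBits : ℕ := 0x6996699696696996966996696996

theorem testBit_thueMorseBits {i : ℕ} (hi : i < 112) :
    thueMorseBits.testBit i = decide (thueMorse i = 1) := by
  induction i using Nat.strong_induction_on with
  | _ i ih =>
    have step : ∀ k < 56, thueMorseBits.testBit (2 * k) = thueMorseBits.testBit k ∧
        thueMorseBits.testBit (2 * k + 1) = !thueMorseBits.testBit k := by
      decide +kernel
    have h0 : thueMorseBits.testBit 0 = false := by decide +kernel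
    obtain ⟨k, rfl | rfl⟩ := Nat.even_or_odd' i
    · rcases Nat.eq_zero_or_pos k with rfl | hk
      · simp [h0, thueMorse_zero]
      · rw [(step k (by omega)).1, ih k (by omega) (by omega), (isDoubling_thueMorse k).1]
    · rw [(step k (by omega)).2, ih k (by omega) (by omega)]
      have := (isDoubling_thueMorse k).2
      rw [← decide_not]
      congr 1
      simp only [eq_iff_iff]
      omega

/-- The word of length `n` at position `s` of the Thue-Morse word, for `s + n ≤ 112`. -/
def factorBits (s n : ℕ) : ℕ :=
  (thueMorseBits >>> s) % 2 ^ n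

/-- Positions at which all factors of length at most `17` occur: the pairs of letters at `0`, `1`, `2`
and `5` are the four words of length two, and the factors are taken from their images under the
fourth power of the morphism. -/
def factorStarts : List ℕ :=
  [0, 1, 2, 5].flatMap fun q => (List.range 16).map fun r => 16 * q + r

/-- Lengths and periods with quotient at least `7 / 3` that are attained at unmatched seams or in
short words. Multiples of a pair are needed where only the multiple occurs; the order,
roughly by frequency, is for speed of evaluation. -/
def highExponents : List (ℕ × ℕ) :=
  [(3, 1), (8, 3), (5, 2), (4, 1), (7, 3), (9, 3), (7, 2), (13, 5), (17, 7), (10, 4), (11, 3),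
    (10, 3), (12, 3), (6, 2), (8, 2), (14, 4), (12, 4), (14, 6)]

/-- Lengths and periods among which those of a maximal repetition in a short word are found. -/
def exponents (n : ℕ) : List (ℕ × ℕ) :=
  if n < 4 then [(2, 1), (1, 1)] else (2, 1) :: (4, 2) :: highExponents

/-- For words of length at most `16`; the circular word is represented by the square of the word. -/
theorem hasMaxRep_short_words : (factorStarts.all fun s => (List.range 16).all fun k =>
    hasMaxRep (factorBits s (k + 1) ||| factorBits s (k + 1) <<< (k + 1)) (2 * (k + 1)) (k + 1)
      (k + 1) (exponents (k + 1))) = true := by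
  decide +kernel

/-- For all unmatched seams between the last `16` letters, taken at `e`, and the first `16` letters,
taken at `s`, of a factor. -/
theorem hasMaxRep_seams : (factorStarts.all fun e => factorStarts.all fun s =>
    (decide ((s + e) % 2 = 0) && !(decide (s % 2 = 1) &&
      thueMorseBits.testBit s == thueMorseBits.testBit (e + 15))) ||
    hasMaxRep (factorBits e 16 ||| factorBits s 16 <<< 16) 32 32 8 highExponents) = true := by
  decide +kernel

/-! ### Classification of the maximal repetitions -/

theorem exists_of_hasMaxRep {D N M P : ℕ} {l : List (ℕ × ℕ)} (hMN : M ≤ N)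
    (hl : ∀ e ∈ l, 1 ≤ e.2 ∧ e.2 ≤ e.1) (h : hasMaxRep D N M P l = true) :
    ∃ e ∈ l, e.1 ≤ M ∧ (∃ j, j + e.1 ≤ N ∧ Rep D.testBit j e.1 e.2) ∧
      ∀ j m p, p ≤ P → 1 ≤ p → m ≤ M → j + m ≤ N → Rep D.testBit j m p →
        m * e.2 ≤ e.1 * p := by
  simp only [hasMaxRep, List.any_eq_true, List.all_eq_true, Bool.and_eq_true,
    decide_eq_true_eq, List.mem_range, Bool.not_eq_true', Bool.and_eq_false_imp] at h
  obtain ⟨e, he, ⟨hM, hrep⟩, hmax⟩ := h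
  obtain ⟨h1, h2⟩ := hl e he
  refine ⟨e, he, hM, (hasRep_iff h2 (by omega)).1 hrep, fun j m p hP hp hm hN hr => ?_⟩
  by_contra! hlt
  have hle : e.1 * p / e.2 + 1 ≤ m := (Nat.div_lt_iff_lt_mul (by omega)).2 hlt
  have hpe : p ≤ e.1 * p / e.2 :=
    (Nat.le_div_iff_mul_le (by omega)).2 (by nlinarith)
  have hno := hmax (p - 1) (by omega)
  rw [Nat.sub_add_cancel hp] at hno
  have hyes := (hasRep_iff (D := D) (N := N) (p := p) (m := e.1 * p / e.2 + 1) (by omega)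
    (by omega)).2 ⟨j, by omega, hr.sub (a := 0) (by omega)⟩
  rw [hno (by omega)] at hyes
  exact absurd hyes (by simp)

theorem rep_testBit_iff {D N o : ℕ} {c : ℕ → Fin 2}
    (h : ∀ i < N, D.testBit i = decide (c (o + i) = 1)) {j m p : ℕ} (hj : j + m ≤ N) :
    Rep D.testBit j m p ↔ Rep c (o + j) m p := by
  refine forall_congr' fun i => forall_congr' fun hi => ?_
  rw [add_assoc j, h _ (by omega), h _ (by omega), decide_eq_decide, ← add_assoc, ← add_assoc,
    ← add_assoc]
  omega

theorem testBit_factorBits {s n i : ℕ} (hs : s + n ≤ 112) :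
    (factorBits s n).testBit i = decide (i < n ∧ thueMorse (s + i) = 1) := by
  rw [factorBits, Nat.testBit_mod_two_pow, Nat.testBit_shiftRight]
  by_cases hi : i < n
  · simp [hi, testBit_thueMorseBits (show s + i < 112 by omega)]
  · simp [hi]

theorem testBit_factorBits_append {s e n k i : ℕ} (hs : s + n ≤ 112) (he : e + k ≤ 112)
    (hi : i < k + n) :
    (factorBits e k ||| factorBits s n <<< k).testBit i =
      decide ((if i < k then thueMorse (e + i) else thueMorse (s + (i - k))) = 1) := by
  rw [Nat.testBit_or, Nat.testBit_shiftLeft, testBit_factorBits hs, testBit_factorBits he]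
  by_cases h : i < k
  · simp [h]
  · simp [h, show i - k < n by omega, Nat.le_of_not_lt h]

theorem thueMorse_two_pow_mul_add {q q' : ℕ} (h0 : thueMorse q = thueMorse q')
    (h1 : thueMorse (q + 1) = thueMorse (q' + 1)) (k : ℕ) :
    ∀ i < 2 ^ (k + 1), thueMorse (2 ^ k * q + i) = thueMorse (2 ^ k * q' + i) := by
  induction k with
  | zero =>
    intro i hi
    obtain rfl | rfl : i = 0 ∨ i = 1 := by omega
    · simpa using h0
    · simpa using h1
  | succ k ih =>
    intro i hi
    have e : ∀ a : ℕ, 2 ^ (k + 1) * a = 2 * (2 ^ k * a) := fun a => by ring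
    rw [e, e]
    obtain ⟨l, rfl | rfl⟩ := Nat.even_or_odd' i
    · rw [← mul_add, ← mul_add]
      exact ((isDoubling_thueMorse.eq_iff _ _).1).2 (ih l (by rw [pow_succ] at hi; omega))
    · rw [← add_assoc, ← add_assoc, ← mul_add, ← mul_add]
      exact ((isDoubling_thueMorse.eq_iff _ _).2).2 (ih l (by rw [pow_succ] at hi; omega))

/-- The position can be taken from the list with the same residue modulo `16`, hence with the same
parity. -/
theorem exists_mem_factorStarts (s : ℕ) : ∃ s' ∈ factorStarts, s' ≤ 95 ∧ s' % 16 = s % 16 ∧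
    ∀ i ≤ 16, thueMorse (s' + i) = thueMorse (s + i) := by
  have pairs : ∃ q ∈ [0, 1, 2, 5], q ≤ 5 ∧ thueMorse (s / 16) = thueMorse q ∧
      thueMorse (s / 16 + 1) = thueMorse (q + 1) := by
    have b : ∀ i < 7, thueMorseBits.testBit i = decide (thueMorse i = 1) :=
      fun i hi => testBit_thueMorseBits (by omega)
    have b0 := b 0 (by omega)
    have b1 := b 1 (by omega)
    have b2 := b 2 (by omega)
    have b3 := b 3 (by omega)
    have b5 := b 5 (by omega)
    have b6 := b 6 (by omega)
    simp [thueMorseBits, Nat.testBit] at b0 b1 b2 b3 b5 b6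
    simp only [List.mem_cons, List.not_mem_nil, or_false, exists_eq_or_imp, exists_eq_left,
      Nat.reduceAdd]
    omega
  obtain ⟨q, hq, hq5, h0, h1⟩ := pairs
  refine ⟨16 * q + s % 16, ?_, by omega, by omega, fun i hi => ?_⟩
  · simp only [factorStarts, List.mem_flatMap, List.mem_map, List.mem_range]
    exact ⟨q, hq, s % 16, Nat.mod_lt _ (by omega), rfl⟩
  · have := thueMorse_two_pow_mul_add h0 h1 4 (s % 16 + i) (by omega)
    rw [show 16 * q + s % 16 + i = 2 ^ 4 * q + (s % 16 + i) by omega, ← this]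
    congr 1
    omega

theorem isMaxRep_of_hasMaxRep {s s' n : ℕ} {l : List (ℕ × ℕ)} (hs : s' + n ≤ 112)
    (heq : ∀ i < n, thueMorse (s' + i) = thueMorse (s + i))
    (hl : ∀ e ∈ l, 1 ≤ e.2 ∧ e.2 ≤ e.1)
    (h : hasMaxRep (factorBits s' n ||| factorBits s' n <<< n) (2 * n) n n l = true) :
    ∃ e ∈ l, IsMaxRep (circular thueMorse s n) n e.1 e.2 := by
  obtain ⟨e, he, hn, ⟨j, hj, hr⟩, hmax⟩ := exists_of_hasMaxRep (by omega) hl h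
  have hbits : ∀ i < 2 * n, (factorBits s' n ||| factorBits s' n <<< n).testBit i =
      decide (circular thueMorse s n (0 + i) = 1) := by
    intro i hi
    rw [testBit_factorBits_append hs hs (by omega), zero_add, circular]
    split_ifs with h
    · rw [heq i h, Nat.mod_eq_of_lt h]
    · rw [heq _ (by omega), Nat.mod_eq_sub_mod (by omega), Nat.mod_eq_of_lt (a := i - n) (by omega)]
  have h1 := (rep_testBit_iff hbits hj).1 hr
  refine ⟨e, he, (hl e he).1, (hl e he).2, hn, ⟨_, h1⟩, fun j' m' p' h1' h2' h3' hr' => ?_⟩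
  have hj' := Nat.mod_lt j' (show 0 < n by omega)
  refine hmax (j' % n) m' p' (by omega) h1' h3' (by omega) ?_
  rw [rep_testBit_iff hbits (by omega), zero_add]
  exact hr'.mod_start

theorem highExponents_spec {e : ℕ × ℕ} (he : e ∈ highExponents) :
    1 ≤ e.2 ∧ e.2 ≤ e.1 ∧ e.1 ≤ 17 ∧ 7 * e.2 ≤ 3 * e.1 ∧ (e.1 / e.2 : ℝ) ∈ U := by
  simp only [highExponents, List.mem_cons, List.not_mem_nil, or_false] at he
  rcases he with rfl | rfl | rfl | rfl | rfl | rfl | rfl | rfl | rfl | rfl | rfl | rfl | rfl | rfl |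
    rfl | rfl | rfl | rfl <;> norm_num [U]

theorem exponents_spec {n : ℕ} {e : ℕ × ℕ} (he : e ∈ exponents n) :
    1 ≤ e.2 ∧ e.2 ≤ e.1 ∧ (e.1 / e.2 : ℝ) ∈ U ∧ (4 ≤ n → 2 * e.2 ≤ e.1) := by
  unfold exponents at he
  split_ifs at he with hn
  · simp only [List.mem_cons, List.not_mem_nil, or_false] at he
    rcases he with rfl | rfl
    · norm_num [U]
    · simp [U, hn]
  · simp only [List.mem_cons] at he
    rcases he with rfl | rfl | he
    · norm_num [U]
    · norm_num [U]
    · obtain ⟨h1, h2, -, h3, h4⟩ := highExponents_spec he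
      exact ⟨h1, h2, h4, fun _ => by omega⟩

theorem exists_isMaxRep_of_le {s n : ℕ} (hn : 0 < n) (hn' : n ≤ 16) :
    ∃ e ∈ exponents n, IsMaxRep (circular thueMorse s n) n e.1 e.2 := by
  obtain ⟨s', hs', hle, -, heq⟩ := exists_mem_factorStarts s
  have h := hasMaxRep_short_words
  simp only [List.all_eq_true, List.mem_range] at h
  have h := h s' hs' (n - 1) (by omega)
  rw [Nat.sub_add_cancel hn] at h
  exact isMaxRep_of_hasMaxRep (by omega) (fun i hi => heq i (by omega))
    (fun e he => ⟨(exponents_spec he).1, (exponents_spec he).2.1⟩) h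

/-- A repetition across the seam with quotient above `7 / 3` has a period of at most `8`, so it lies
within `16` letters of the seam. Such a quotient is always attained there. -/
theorem exists_isMaxRep_of_not_matchedSeam {s n : ℕ} (hn : 16 < n) (hb : ¬ MatchedSeam s n) :
    ∃ e ∈ highExponents, IsMaxRep (circular thueMorse s n) n e.1 e.2 := by
  obtain ⟨a, ha, hale, hamod, haeq⟩ := exists_mem_factorStarts s
  obtain ⟨b, hbm, hble, hbmod, hbeq⟩ := exists_mem_factorStarts (s + n - 16)
  have h := hasMaxRep_seams
  simp only [List.all_eq_true] at h
  have h := h b hbm a ha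
  rw [Bool.or_eq_true, or_iff_right] at h
  swap
  · simp only [Bool.and_eq_true, decide_eq_true_eq, Bool.not_eq_true', Bool.and_eq_false_imp,
      beq_eq_false_iff_ne, not_and]
    intro hpar hne
    refine hb ⟨by omega, fun hs heq => hne (by omega) ?_⟩
    rw [testBit_thueMorseBits (by omega), testBit_thueMorseBits (by omega),
      hbeq 15 (by omega), show s + n - 16 + 15 = s + n - 1 by omega, ← heq]
    have := haeq 0 (by omega)
    simp only [add_zero] at this
    rw [this]
  obtain ⟨e, he, -, ⟨j, hj, hr⟩, hmax⟩ := exists_of_hasMaxRep le_rfl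
    (fun e he => ⟨(highExponents_spec he).1, (highExponents_spec he).2.1⟩) h
  obtain ⟨e1, e2, e3, e4, -⟩ := highExponents_spec he
  have hbits : ∀ i < 32, (factorBits b 16 ||| factorBits a 16 <<< 16).testBit i =
      decide (circular thueMorse s n (n - 16 + i) = 1) := by
    intro i hi
    rw [testBit_factorBits_append (by omega) (by omega) (by omega)]
    split_ifs with h
    · rw [hbeq i (by omega), circular_left _ _ (by omega),
        show s + n - 16 = s + (n - 16) by omega]
    · rw [haeq _ (by omega), circular_right _ _ (by omega) (by omega),
        show n - 16 + i - n = i - 16 by omega]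
  refine ⟨e, he, e1, e2, by omega, ⟨_, (rep_testBit_iff hbits hj).1 hr⟩, ?_⟩
  intro j' m' p' h1 h2 h3 hr'
  -- the exponent found at the seam is at least `7 / 3`
  by_cases hlow : 3 * m' ≤ 7 * p'
  · nlinarith
  replace hr' := hr'.mod_start
  have hj' := Nat.mod_lt j' (show 0 < n by omega)
  have hp8 : p' ≤ 8 := by
    by_contra! hp8
    have := rep_length_le_of_not_matchedSeam hb (by omega) hj' h3 hr'
    omega
  have hs : n < j' % n + m' := by
    by_contra! hs
    have : Rep thueMorse (s + j' % n) m' p' :=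
      hr'.of_eq fun i hi => by rw [circular_left _ _ (by omega)]
    have := thueMorse_overlap_free h1 this
    omega
  obtain ⟨hu, hv⟩ := hr'.circular_parts h1 hj' h3 hs.le
  refine hmax (j' % n + 16 - n) m' p' hp8 h1 (by omega) (by omega) ?_
  rw [rep_testBit_iff hbits (by omega)]
  rwa [show n - 16 + (j' % n + 16 - n) = j' % n by omega]

theorem exists_isMaxRep {n : ℕ} (hn : 0 < n) (s : ℕ) :
    ∃ m p : ℕ, IsMaxRep (circular thueMorse s n) n m p ∧ (m / p : ℝ) ∈ U ∧
      (4 ≤ n → 2 * p ≤ m) := by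
  induction n using Nat.strong_induction_on generalizing s with
  | _ n ih =>
    by_cases hn16 : n ≤ 16
    · obtain ⟨e, he, h⟩ := exists_isMaxRep_of_le (s := s) hn hn16
      exact ⟨e.1, e.2, h, (exponents_spec he).2.2⟩
    by_cases hm : MatchedSeam s n
    · obtain ⟨k, rfl⟩ : ∃ k, n = 2 * k := ⟨n / 2, by have := hm.1; omega⟩
      obtain ⟨o, ho, s', hd⟩ := hm.exists_isDoubling (by omega)
      obtain ⟨m, p, h, hU, hmp⟩ := ih k (by omega) (by omega) s'
      have h2 := hmp (by omega)
      refine ⟨2 * m, 2 * p, h.double ho (circular_add _ _ _) hd h2, ?_, fun _ => by omega⟩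
      push_cast
      rwa [mul_div_mul_left _ _ two_ne_zero]
    · obtain ⟨e, he, h⟩ := exists_isMaxRep_of_not_matchedSeam (by omega) hm
      obtain ⟨-, -, -, h4, h5⟩ := highExponents_spec he
      exact ⟨e.1, e.2, h, h5, fun _ => by omega⟩

theorem IsMaxRep.ccexp_eq {α : Type*} {t : ℕ → α} {s n m p : ℕ}
    (h : IsMaxRep (circular t s n) n m p) : ccexp (block t s n) = m / p := by
  obtain ⟨j, hj⟩ := h.exists_rep
  exact ccexp_block t h.one_le h.le h.length_le hj h.maximal

/-! ### Attained values and the theorem -/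

theorem exists_ccexp_eq {u : ℝ} (s n m p : ℕ) (hu : (m / p : ℝ) = u)
    (h : (decide (s + n ≤ 112 ∧ 1 ≤ p ∧ p ≤ m) &&
      hasMaxRep (factorBits s n ||| factorBits s n <<< n) (2 * n) n n [(m, p)]) = true) :
    ∃ x : List (Fin 2), x ≠ [] ∧ IsFactorOf x thueMorse ∧ ccexp x = u := by
  rw [Bool.and_eq_true, decide_eq_true_eq] at h
  obtain ⟨⟨hs, hp, hm⟩, h⟩ := h
  obtain ⟨e, he, h⟩ := isMaxRep_of_hasMaxRep (s := s) hs (fun _ _ => rfl)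
    (by simpa using ⟨hp, hm⟩) h
  rw [List.mem_singleton] at he
  subst he
  refine ⟨block thueMorse s n, ?_, ⟨s, n, rfl⟩, h.ccexp_eq.trans hu⟩
  have := h.length_le
  rw [← List.length_pos_iff, length_block]
  exact (hp.trans hm).trans this

end CircularWords

open CircularWords in
theorem theorem7 :
    (∀ x : List (Fin 2), x ≠ [] → CircularWords.IsFactorOf x CircularWords.thueMorse →
      CircularWords.ccexp x ∈ CircularWords.U) ∧
    (∀ u ∈ CircularWords.U, ∃ x : List (Fin 2), x ≠ [] ∧
      CircularWords.IsFactorOf x CircularWords.thueMorse ∧ CircularWords.ccexp x = u) := by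
  refine ⟨?_, ?_⟩
  · rintro x hx ⟨s, n, rfl⟩
    rw [← List.length_pos_iff, length_block] at hx
    obtain ⟨m, p, h, hU, -⟩ := exists_isMaxRep hx s
    rwa [h.ccexp_eq]
  · rintro u (rfl | rfl | rfl | rfl | rfl | rfl | rfl | rfl | rfl | rfl | rfl | rfl)
    · exact exists_ccexp_eq 0 1 1 1 (by norm_num) (by decide +kernel)
    · exact exists_ccexp_eq 1 2 2 1 (by norm_num) (by decide +kernel)
    · exact exists_ccexp_eq 3 7 7 3 (by norm_num) (by decide +kernel)
    · exact exists_ccexp_eq 19 23 17 7 (by norm_num) (by decide +kernel)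
    · exact exists_ccexp_eq 0 5 5 2 (by norm_num) (by decide +kernel)
    · exact exists_ccexp_eq 8 13 13 5 (by norm_num) (by decide +kernel)
    · exact exists_ccexp_eq 0 9 8 3 (by norm_num) (by decide +kernel)
    · exact exists_ccexp_eq 1 4 3 1 (by norm_num) (by decide +kernel)
    · exact exists_ccexp_eq 3 10 10 3 (by norm_num) (by decide +kernel)
    · exact exists_ccexp_eq 10 7 7 2 (by norm_num) (by decide +kernel)
    · exact exists_ccexp_eq 3 18 11 3 (by norm_num) (by decide +kernel)
    · exact exists_ccexp_eq 5 6 4 1 (by norm_num) (by decide +kernel)
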